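/- A Pisot number is a real algebraic integer $\beta>1$ all of whose Galois conjugates other than $\beta$ have modulus strictly less than $1$. Let $\pi\colon\mathbb{R}\to\mathbb{R}/\mathbb{Z}$ be the projection. For a sequence $x_\bullet=(x_k)_{k\ge 1}$ of real numbers, let $\mathsf{Spec_{fin}}(x_\bullet)$ (respectively $\mathsf{Spec_{count}}(x_\bullet)$) be the set of $\theta\in\mathbb{R}/\mathbb{Z}$ such that the sequence $(\pi(x_k)-k\theta)_{k\ge 1}$ in $\mathbb{R}/\mathbb{Z}$ has only finitely many (respectively at most countably many) limit values, where a limit value of a sequence is a limit of a convergent subsequence. Let $\alpha$ be a real algebraic number with $|\alpha|>1$, let $F(x)\in\mathbb{R}[x]$ be a nonzero polynomial, and let $x_k=F(k)\alpha^k$ for $k\ge 1$. Then $$\mathsf{Spec_{fin}}(x_\bullet)=\begin{cases}\mathbb{Q}/\mathbb{Z} & \text{if } |\alpha| \text{ is a Pisot number and } F(x)\in\mathbb{Q}(\alpha)[x],\\ \emptyset & \text{otherwise.}\end{cases}$$ Moreover, $\mathsf{Spec_{count}}(x_\bullet)\subseteq\mathbb{Q}/\mathbb{Z}$. -/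

import Mathlib

/-- A Pisot number: a real algebraic integer `a > 1` all of whose Galois conjugates (in `ℂ`,
over `ℚ`) other than `a` itself have modulus strictly less than `1`. -/
def IsPisot (a : ℝ) : Prop :=
  IsIntegral ℤ a ∧ 1 < a ∧ ∀ z : ℂ, IsConjRoot ℚ (a : ℂ) z → z ≠ (a : ℂ) → ‖z‖ < 1

/-- The set of limit values of the sequence `π(x_k) - k θ` in `ℝ / ℤ`, where `π : ℝ → ℝ / ℤ` is
the projection: the points each of whose neighbourhoods contains infinitely many terms (counted
with their indices). It does not depend on the term of index `0`, so a sequence `(x_k)_{k ≥ 1}` is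
represented by any function `ℕ → ℝ` that agrees with it for `k ≥ 1`. -/
def limitValues (x : ℕ → ℝ) (θ : UnitAddCircle) : Set UnitAddCircle :=
  {l | MapClusterPt l Filter.atTop (fun k : ℕ => (x k : UnitAddCircle) - k • θ)}

/-- The `θ` in `ℝ / ℤ` for which `π(x_k) - k θ` has finitely many limit values. -/
def specFin (x : ℕ → ℝ) : Set UnitAddCircle :=
  {θ | (limitValues x θ).Finite}

/-- The `θ` in `ℝ / ℤ` for which `π(x_k) - k θ` has (at most) countably many limit values. -/
def specCount (x : ℕ → ℝ) : Set UnitAddCircle :=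
  {θ | (limitValues x θ).Countable}

/-- `ℚ / ℤ` as a subset of `ℝ / ℤ`. -/
def ratModInt : Set UnitAddCircle :=
  Set.range (fun q : ℚ => ((q : ℝ) : UnitAddCircle))

/-! Let E be the shift, P the minimal polynomial of α and n = deg F + 1. Then P(E)^n kills x, so
some S(E) with S in ℤ[X] and S(1) ≠ 0 does too, since α ≠ 1. Integer combinations of shifts preserve
countability of the set of limit values, and S(E) turns π(x_k) - kθ into -k S(1)θ plus a constant.
For irrational θ the latter accumulates at every point of the circle, so θ must be rational
(`specCount_subset_ratModInt`). For rational θ the term kθ takes finitely many values, so finiteness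
no longer depends on θ.

Finitely many limit values of π(x_k) means x = p + l + e with p integral, l finitely valued and e
null. Integrality forces p + l to satisfy the recurrence eventually, and a ℚ-linear retraction ℂ → ℚ
turns this into x = q + w + e with q rational, eventually satisfying the recurrence, and w finitely
valued (`exists_rational_add_finite`). Over K = ℚ(α), a polynomial A(E) projects onto the α-part of
the solutions. It fixes x, and it kills w + e eventually because |α| > 1 leaves no bounded α-part;
hence x = A(E)q eventually. So F has coefficients in K and α is integral. Conjugating by α ↦ z ≠ α
makes F^σ(k) z^k a finitely valued sequence plus a null one, which forces |z| < 1
(`pisot_of_finite_fractional_parts`).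

Conversely, the trace of D c α^k is an integer for a suitable D, and its terms from the other
embeddings decay, so c k^j α^k is within o(1) of ℤ/D (`monomial_mem_finiteClusterSeq`). -/

open Polynomial Filter Topology IntermediateField

/-! ### Polynomials in the shift acting on sequences -/

/-- The shift `(u k) ↦ (u (k + 1))` on sequences. -/
def seqShift (R M : Type*) [CommSemiring R] [AddCommMonoid M] [Module R M] :
    Module.End R (ℕ → M) :=
  LinearMap.funLeft R M Nat.succ

/-- The linear recurrence operator attached to a polynomial: the polynomial in the shift. -/
noncomputable def polyShift {R M : Type*} [CommSemiring R] [AddCommMonoid M] [Module R M]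
    (p : R[X]) : Module.End R (ℕ → M) :=
  aeval (seqShift R M) p

section PolyShift

variable {R M : Type*} [CommSemiring R] [AddCommMonoid M] [Module R M]

theorem seqShift_apply (u : ℕ → M) (k : ℕ) : seqShift R M u k = u (k + 1) := rfl

theorem seqShift_pow_apply (n : ℕ) (u : ℕ → M) (k : ℕ) :
    (seqShift R M ^ n) u k = u (k + n) := by
  induction n generalizing k with
  | zero => simp
  | succ n ih =>
    rw [pow_succ', Module.End.mul_apply, seqShift_apply, ih]
    congr 1
    omega

theorem polyShift_monomial_apply (n : ℕ) (a : R) (u : ℕ → M) (k : ℕ) :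
    polyShift (monomial n a) u k = a • u (k + n) := by
  simp [polyShift, aeval_monomial, Module.algebraMap_end_apply, seqShift_pow_apply]

theorem polyShift_add (p q : R[X]) (u : ℕ → M) :
    polyShift (p + q) u = polyShift p u + polyShift q u := by
  simp [polyShift]

theorem polyShift_mul (p q : R[X]) (u : ℕ → M) :
    polyShift (p * q) u = polyShift p (polyShift q u) := by
  simp [polyShift]

theorem polyShift_one (u : ℕ → M) : polyShift (1 : R[X]) u = u := by
  simp [polyShift]

theorem polyShift_C_apply (a : R) (u : ℕ → M) : polyShift (C a) u = a • u := by
  simp [polyShift, Module.algebraMap_end_apply]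

theorem polyShift_X_apply (u : ℕ → M) (k : ℕ) : polyShift (X : R[X]) u k = u (k + 1) := by
  simp [polyShift, seqShift_apply]

theorem polyShift_apply_eq_sum (p : R[X]) (u : ℕ → M) (k : ℕ) :
    polyShift p u k = ∑ i ∈ Finset.range (p.natDegree + 1), p.coeff i • u (k + i) := by
  rw [polyShift, aeval_eq_sum_range]
  simp [seqShift_pow_apply]

theorem polyShift_mem (N : Submodule R (ℕ → M)) (hN : ∀ u ∈ N, (fun k => u (k + 1)) ∈ N)
    (p : R[X]) {u : ℕ → M} (hu : u ∈ N) : polyShift p u ∈ N := by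
  have hpow : ∀ n : ℕ, (fun k => u (k + n)) ∈ N := by
    intro n
    induction n with
    | zero => exact hu
    | succ n ih =>
      have := hN _ ih
      simpa only [add_right_comm _ 1 n, add_assoc] using! this
  have : polyShift p u =
      ∑ i ∈ Finset.range (p.natDegree + 1), p.coeff i • (fun k => u (k + i)) := by
    ext k
    rw [polyShift_apply_eq_sum]
    simp
  rw [this]
  exact N.sum_mem fun i _ => N.smul_mem _ (hpow i)

/-- Semilinear maps commute with recurrences. This serves for ℤ → ℂ, field embeddings, the
retraction ℂ → ℚ and the projection to the circle. -/
theorem polyShift_map {S N : Type*} [CommSemiring S] [AddCommMonoid N] [Module S N]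
    (f : R →+* S) (g : M →+ N) (hg : ∀ r m, g (r • m) = f r • g m) (p : R[X]) (u : ℕ → M) (k : ℕ) :
    polyShift (p.map f) (fun j => g (u j)) k = g (polyShift p u k) := by
  induction p using Polynomial.induction_on' with
  | add p q hp hq => simp [polyShift_add, hp, hq]
  | monomial n a => simp [polyShift_monomial_apply, hg]

end PolyShift

/-! ### Shift-stable classes of sequences -/

section Submodules

variable (R M : Type*) [CommRing R] [AddCommGroup M] [Module R M]

/-- Sequences that vanish from some index on. -/
def eventuallyZeroSeq : Submodule R (ℕ → M) where
  carrier := {u | ∀ᶠ k in atTop, u k = 0}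
  add_mem' {u v} hu hv := by
    filter_upwards [hu, hv] with k h1 h2
    simp [h1, h2]
  zero_mem' := by simp
  smul_mem' c u hu := by
    filter_upwards [hu] with k h
    simp [h]

/-- Sequences with finitely many values. -/
def finiteRangeSeq : Submodule R (ℕ → M) where
  carrier := {u | (Set.range u).Finite}
  add_mem' {u v} hu hv := by
    refine (Set.Finite.image2 (· + ·) hu hv).subset ?_
    rintro _ ⟨k, rfl⟩
    exact ⟨u k, ⟨k, rfl⟩, v k, ⟨k, rfl⟩, rfl⟩
  zero_mem' := by
    exact (Set.finite_singleton (0 : M)).subset (by rintro _ ⟨k, rfl⟩; simp)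
  smul_mem' c u hu := by
    refine (Set.Finite.image (c • ·) hu).subset ?_
    rintro _ ⟨k, rfl⟩
    exact ⟨u k, ⟨k, rfl⟩, rfl⟩

variable {R M}

theorem polyShift_eventually_eq_zero (p : R[X]) {u : ℕ → M} (hu : ∀ᶠ k in atTop, u k = 0) :
    ∀ᶠ k in atTop, polyShift p u k = 0 :=
  polyShift_mem (eventuallyZeroSeq R M) (fun _ h => (tendsto_add_atTop_nat 1).eventually h) p hu

theorem polyShift_finite_range (p : R[X]) {u : ℕ → M} (hu : (Set.range u).Finite) :
    (Set.range (polyShift p u)).Finite :=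
  polyShift_mem (finiteRangeSeq R M) (fun _ (h : (Set.range _).Finite) => h.subset
    (by rintro _ ⟨k, rfl⟩; exact ⟨k + 1, rfl⟩)) p hu

end Submodules

/-! ### Exponential polynomials over ℂ -/

section Complex

/-- Bounded complex sequences. -/
def boundedSeq : Submodule ℂ (ℕ → ℂ) where
  carrier := {u | ∃ C, ∀ k, ‖u k‖ ≤ C}
  add_mem' {u v} := by
    rintro ⟨C, hC⟩ ⟨D, hD⟩
    exact ⟨C + D, fun k => (norm_add_le _ _).trans (add_le_add (hC k) (hD k))⟩
  zero_mem' := ⟨0, by simp⟩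
  smul_mem' c u := by
    rintro ⟨C, hC⟩
    refine ⟨‖c‖ * C, fun k => ?_⟩
    simpa using mul_le_mul_of_nonneg_left (hC k) (norm_nonneg c)

/-- Complex sequences that tend to zero. -/
def nullSeq : Submodule ℂ (ℕ → ℂ) where
  carrier := {u | Tendsto u atTop (𝓝 0)}
  add_mem' {u v} hu hv := by simpa using! Tendsto.add hu hv
  zero_mem' := tendsto_const_nhds
  smul_mem' c u hu := by simpa using! Tendsto.const_mul c hu

theorem polyShift_bounded (p : ℂ[X]) {u : ℕ → ℂ} (hu : ∃ C, ∀ k, ‖u k‖ ≤ C) :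
    ∃ C, ∀ k, ‖polyShift p u k‖ ≤ C :=
  polyShift_mem boundedSeq (fun _ ⟨C, hC⟩ => ⟨C, fun k => hC (k + 1)⟩) p hu

theorem polyShift_tendsto_zero (p : ℂ[X]) {u : ℕ → ℂ} (hu : Tendsto u atTop (𝓝 0)) :
    Tendsto (polyShift p u) atTop (𝓝 0) :=
  polyShift_mem nullSeq (fun _ (h : Tendsto _ _ _) => h.comp (tendsto_add_atTop_nat 1)) p hu

/-- A bounded solution of the recurrence `(E - a) u = 0` with `|a| > 1` vanishes eventually. -/
theorem eventually_eq_zero_of_bounded_of_step {a : ℂ} (ha : 1 < ‖a‖) {u : ℕ → ℂ}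
    (hu : ∃ C, ∀ k, ‖u k‖ ≤ C) (h : ∀ᶠ k in atTop, polyShift (X - C a) u k = 0) :
    ∀ᶠ k in atTop, u k = 0 := by
  obtain ⟨D, hD⟩ := hu
  obtain ⟨N, hN⟩ := eventually_atTop.1 h
  have hstep : ∀ k ≥ N, u (k + 1) = a * u k := by
    intro k hk
    have := hN k hk
    rw [sub_eq_add_neg, ← C_neg, polyShift_add, polyShift_C_apply, Pi.add_apply,
      polyShift_X_apply] at this
    simp only [Pi.smul_apply, smul_eq_mul] at this
    linear_combination this
  refine eventually_atTop.2 ⟨N, fun k hk => ?_⟩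
  have hpow : ∀ n, u (k + n) = a ^ n * u k := by
    intro n
    induction n with
    | zero => simp
    | succ n ih => rw [← add_assoc, hstep _ (by omega), ih]; ring
  by_contra hne
  have hpos : 0 < ‖u k‖ := norm_pos_iff.2 hne
  obtain ⟨n, hn⟩ := pow_unbounded_of_one_lt (D / ‖u k‖) ha
  have := hD (k + n)
  rw [hpow, norm_mul, norm_pow] at this
  rw [div_lt_iff₀ hpos] at hn
  linarith

theorem eventually_eq_zero_of_bounded {a : ℂ} (ha : 1 < ‖a‖) (n : ℕ) {u : ℕ → ℂ}
    (hu : ∃ C, ∀ k, ‖u k‖ ≤ C) (h : ∀ᶠ k in atTop, polyShift ((X - C a) ^ n) u k = 0) :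
    ∀ᶠ k in atTop, u k = 0 := by
  induction n generalizing u with
  | zero => simpa [polyShift_one] using h
  | succ n ih =>
    rw [pow_succ, polyShift_mul] at h
    exact eventually_eq_zero_of_bounded_of_step ha hu (ih (polyShift_bounded _ hu) h)

/-- `taylor 1 F` is F(X + 1), with the same degree and leading coefficient as F, so differencing
lowers the degree. -/
theorem degree_taylor_sub_lt {F : ℂ[X]} {n : ℕ} (hF : F.degree < (n + 1 : ℕ)) :
    (taylor 1 F - F).degree < n := by
  by_cases h0 : F = 0
  · simp [h0, bot_lt_iff_ne_bot]
  · have h1 : (taylor 1 F - F).degree < F.degree := by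
      have := degree_sub_lt_left (p := taylor 1 F) (q := F) (by simp) (by simpa using h0)
        (by simp [leadingCoeff_taylor])
      simpa using this
    refine h1.trans_le ?_
    rw [degree_eq_natDegree h0] at hF ⊢
    exact_mod_cast Nat.lt_succ_iff.1 (by exact_mod_cast hF)

theorem taylor_sub_ne_zero {F : ℂ[X]} (hF : F.natDegree ≠ 0) : taylor 1 F - F ≠ 0 := by
  intro h
  have hstep : ∀ n : ℕ, F.eval (n : ℂ) = F.eval 0 := by
    intro n
    induction n with
    | zero => simp
    | succ n ih =>
      rw [← ih]
      have := congrArg (eval (n : ℂ)) h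
      simp only [eval_sub, taylor_eval, eval_zero] at this
      push_cast
      linear_combination this
  have hC : F = C (F.eval 0) := by
    refine eq_of_infinite_eval_eq _ _ ((Set.infinite_range_of_injective
      (Nat.cast_injective (R := ℂ))).mono ?_)
    rintro _ ⟨n, rfl⟩
    simpa using hstep n
  rw [hC] at hF
  simp at hF

theorem polyShift_X_sub_C_eval_mul_pow (F : ℂ[X]) (a : ℂ) :
    polyShift (X - C a) (fun k => F.eval (k : ℂ) * a ^ k) =
      a • fun k : ℕ => (taylor 1 F - F).eval (k : ℂ) * a ^ k := by
  ext k
  rw [sub_eq_add_neg, ← C_neg, polyShift_add, polyShift_C_apply, Pi.add_apply, polyShift_X_apply]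
  simp only [Pi.smul_apply, smul_eq_mul, eval_sub, taylor_eval, Nat.cast_add, Nat.cast_one]
  ring

theorem polyShift_X_sub_C_pow_eval_mul_pow (a : ℂ) (n : ℕ) {F : ℂ[X]} (hF : F.degree < n) :
    polyShift ((X - C a) ^ n) (fun k => F.eval (k : ℂ) * a ^ k) = 0 := by
  induction n generalizing F with
  | zero =>
    have : F = 0 := by simpa using hF
    ext k
    simp [this, polyShift_one]
  | succ n ih =>
    rw [pow_succ, polyShift_mul, polyShift_X_sub_C_eval_mul_pow, map_smul,
      ih (degree_taylor_sub_lt hF), smul_zero]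

theorem polyShift_eval_mul_pow_of_dvd {a : ℂ} {n : ℕ} {F : ℂ[X]} (hF : F.degree < n) {p : ℂ[X]}
    (hp : (X - C a) ^ n ∣ p) : polyShift p (fun k => F.eval (k : ℂ) * a ^ k) = 0 := by
  obtain ⟨q, rfl⟩ := hp
  rw [mul_comm, polyShift_mul, polyShift_X_sub_C_pow_eval_mul_pow a n hF, map_zero]

/-- If the values `F(k) a ^ k` eventually lie in a finitely generated `ℤ`-module, then `a` is an
algebraic integer. -/
theorem isIntegral_of_eval_mul_pow_mem {a : ℂ} (ha : a ≠ 0) {F : ℂ[X]} (hF : F ≠ 0)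
    (M : Submodule ℤ ℂ) (hM : M.FG) (h : ∀ᶠ k : ℕ in atTop, F.eval (k : ℂ) * a ^ k ∈ M) :
    IsIntegral ℤ a := by
  induction hn : F.natDegree using Nat.strong_induction_on generalizing F M with
  | _ n ih =>
  by_cases h0 : n = 0
  · obtain ⟨c, hc⟩ := natDegree_eq_zero.1 (hn.trans h0)
    have hc0 : c ≠ 0 := by rintro rfl; simp at hc; exact hF hc.symm
    obtain ⟨N, hN⟩ := eventually_atTop.1 h
    have hfg : (M.map (LinearMap.mulLeft ℤ (c * a ^ N)⁻¹)).FG := hM.map _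
    -- For constant F, rescaling M by (c a^N)⁻¹ captures every power of a, so ℤ[a] is finitely
    -- generated.
    have hle : Subalgebra.toSubmodule (Algebra.adjoin ℤ {a}) ≤
        M.map (LinearMap.mulLeft ℤ (c * a ^ N)⁻¹) := by
      rw [Algebra.adjoin_eq_span, Submodule.span_le]
      intro y hy
      obtain ⟨k, rfl⟩ := Submonoid.mem_closure_singleton.1 hy
      refine ⟨c * a ^ (N + k), ?_, ?_⟩
      · have := hN (N + k) (by omega)
        rwa [← hc, eval_C] at this
      · simp only [LinearMap.mulLeft_apply]
        field_simp
        ring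
    exact IsIntegral.of_mem_of_fg _ (hfg.of_le hle) _ (Algebra.subset_adjoin rfl)
  · have hd : (taylor 1 F - F).natDegree < n := by
      have := degree_taylor_sub_lt (F := F) (n := n)
        (by rw [degree_eq_natDegree hF, hn]; exact_mod_cast Nat.lt_succ_self n)
      exact (natDegree_lt_iff_degree_lt (taylor_sub_ne_zero (by omega))).2 this
    -- The difference F(X + 1) - F has its values in a⁻¹M + M, still finitely generated.
    refine ih _ hd (taylor_sub_ne_zero (by omega))
      (M.map (LinearMap.mulLeft ℤ a⁻¹) ⊔ M) ((hM.map _).sup hM) ?_ rfl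
    filter_upwards [h, (tendsto_add_atTop_nat 1).eventually h] with k h1 h2
    have : (taylor 1 F - F).eval (k : ℂ) * a ^ k =
        a⁻¹ * (F.eval ((k + 1 : ℕ) : ℂ) * a ^ (k + 1)) - F.eval (k : ℂ) * a ^ k := by
      simp only [eval_sub, taylor_eval, Nat.cast_add, Nat.cast_one]
      field_simp
      ring
    rw [this]
    exact Submodule.sub_mem _ (Submodule.mem_sup_left ⟨_, h2, rfl⟩) (Submodule.mem_sup_right h1)

/-- A polynomial whose values at large integers lie in a subfield has coefficients in it. -/
theorem exists_map_eq_of_eventually_eval_mem {K : Type*} [Field K] (f : K →+* ℂ) (F : ℂ[X])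
    (h : ∀ᶠ k : ℕ in atTop, F.eval (k : ℂ) ∈ f.range) : ∃ G : K[X], G.map f = F := by
  have : CharZero K := f.charZero
  obtain ⟨N, hN⟩ := eventually_atTop.1 h
  choose! v hv using hN
  -- deg F + 1 nodes beyond N: Lagrange interpolation over K recovers F.
  let s := Finset.Icc N (N + F.natDegree)
  have hinj : Set.InjOn (fun k : ℕ => (k : K)) s := Nat.cast_injective.injOn
  refine ⟨Lagrange.interpolate s (fun k : ℕ => (k : K)) v, ?_⟩
  have hcard : s.card = F.natDegree + 1 := by simp [s]; omega
  have hs : (s.image (fun k : ℕ => (k : ℂ))).card = F.natDegree + 1 := by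
    rw [Finset.card_image_of_injective _ Nat.cast_injective, hcard]
  refine eq_of_degrees_lt_of_eval_finset_eq (s.image (fun k : ℕ => (k : ℂ))) ?_ ?_ ?_
  · rw [hs, degree_map, ← hcard]
    exact Lagrange.degree_interpolate_lt v hinj
  · rw [hs]
    exact degree_le_natDegree.trans_lt (by exact_mod_cast Nat.lt_succ_self _)
  · intro x hx
    obtain ⟨k, hk, rfl⟩ := Finset.mem_image.1 hx
    have h1 := Lagrange.eval_interpolate_at_node v hinj hk
    rw [← map_natCast f k, eval_map_apply, h1, map_natCast]
    exact hv k (Finset.mem_Icc.1 hk).1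

end Complex

/-! ### Limit values in compact groups -/

section ClusterPoints

/-- By compactness, an ultrafilter along which the sum converges also makes each summand converge.
-/
theorem MapClusterPt.exists_add {G ι : Type*} [AddCommGroup G] [TopologicalSpace G] [T2Space G]
    [IsTopologicalAddGroup G] [CompactSpace G] {f : Filter ι} {u v : ι → G} {l : G}
    (h : MapClusterPt l f (u + v)) :
    ∃ a b, MapClusterPt a f u ∧ MapClusterPt b f v ∧ a + b = l := by
  obtain ⟨U, hU, hl⟩ := mapClusterPt_iff_ultrafilter.1 h
  obtain ⟨a, -, ha⟩ := isCompact_univ.ultrafilter_le_nhds (U.map u) (by simp)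
  obtain ⟨b, -, hb⟩ := isCompact_univ.ultrafilter_le_nhds (U.map v) (by simp)
  have ha' : Tendsto u U (𝓝 a) := ha
  have hb' : Tendsto v U (𝓝 b) := hb
  exact ⟨a, b, mapClusterPt_iff_ultrafilter.2 ⟨U, hU, ha'⟩,
    mapClusterPt_iff_ultrafilter.2 ⟨U, hU, hb'⟩, tendsto_nhds_unique (ha'.add hb') hl⟩

theorem MapClusterPt.exists_of_comp {G H ι : Type*} [TopologicalSpace G] [CompactSpace G]
    [TopologicalSpace H] [T2Space H] {f : Filter ι} {u : ι → G} {g : G → H} (hg : Continuous g)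
    {l : H} (h : MapClusterPt l f (fun i => g (u i))) : ∃ a, MapClusterPt a f u ∧ g a = l := by
  obtain ⟨U, hU, hl⟩ := mapClusterPt_iff_ultrafilter.1 h
  obtain ⟨a, -, ha⟩ := isCompact_univ.ultrafilter_le_nhds (U.map u) (by simp)
  have ha' : Tendsto u U (𝓝 a) := ha
  exact ⟨a, mapClusterPt_iff_ultrafilter.2 ⟨U, hU, ha'⟩,
    tendsto_nhds_unique ((hg.tendsto a).comp ha') hl⟩

theorem MapClusterPt.mem_of_isClosed {G ι : Type*} [TopologicalSpace G] {f : Filter ι}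
    {u : ι → G} {l : G} (h : MapClusterPt l f u) {s : Set G} (hs : IsClosed s)
    (hu : ∀ᶠ i in f, u i ∈ s) : l ∈ s := by
  obtain ⟨U, hU, hl⟩ := mapClusterPt_iff_ultrafilter.1 h
  exact hs.mem_of_tendsto hl (hU hu)

variable (G : Type*) [AddCommGroup G] [TopologicalSpace G] [T2Space G]
  [IsTopologicalAddGroup G] [CompactSpace G]

/-- Sequences in a compact group with countably many limit values. -/
def countableClusterSeq : Submodule ℤ (ℕ → G) where
  carrier := {u | {l | MapClusterPt l atTop u}.Countable}
  add_mem' {u v} hu hv := by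
    refine (Set.Countable.image2 hu hv (· + ·)).mono ?_
    intro l hl
    obtain ⟨a, b, ha, hb, h⟩ := MapClusterPt.exists_add hl
    exact ⟨a, ha, b, hb, h⟩
  zero_mem' := by
    refine (Set.countable_singleton (0 : G)).mono fun l hl => ?_
    exact MapClusterPt.mem_of_isClosed hl isClosed_singleton (by simp)
  smul_mem' c u hu := by
    refine (Set.Countable.image hu (c • ·)).mono ?_
    intro l hl
    exact MapClusterPt.exists_of_comp (g := fun x : G => c • x) (continuous_zsmul c) hl

/-- Sequences in a compact group with finitely many limit values. -/
def finiteClusterSeq : Submodule ℤ (ℕ → G) where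
  carrier := {u | {l | MapClusterPt l atTop u}.Finite}
  add_mem' {u v} hu hv := by
    refine (Set.Finite.image2 (· + ·) hu hv).subset ?_
    intro l hl
    obtain ⟨a, b, ha, hb, h⟩ := MapClusterPt.exists_add hl
    exact ⟨a, ha, b, hb, h⟩
  zero_mem' := by
    refine (Set.finite_singleton (0 : G)).subset fun l hl => ?_
    exact MapClusterPt.mem_of_isClosed hl isClosed_singleton (by simp)
  smul_mem' c u hu := by
    refine (Set.Finite.image (c • ·) hu).subset ?_
    intro l hl
    exact MapClusterPt.exists_of_comp (g := fun x : G => c • x) (continuous_zsmul c) hl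

variable {G}

theorem mem_finiteClusterSeq_of_finite_range {u : ℕ → G} (hu : (Set.range u).Finite) :
    u ∈ finiteClusterSeq G :=
  hu.subset fun _ hl => MapClusterPt.mem_of_isClosed hl hu.isClosed (by simp)

theorem mem_finiteClusterSeq_of_tendsto {u : ℕ → G} {a : G} (hu : Tendsto u atTop (𝓝 a)) :
    u ∈ finiteClusterSeq G := by
  refine (Set.finite_singleton a).subset fun l hl => ?_
  obtain ⟨U, hU, hl⟩ := mapClusterPt_iff_ultrafilter.1 hl
  exact tendsto_nhds_unique hl (hu.mono_left hU)

theorem polyShift_countable_cluster (p : ℤ[X]) {u : ℕ → G}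
    (hu : {l | MapClusterPt l atTop u}.Countable) :
    {l | MapClusterPt l atTop (polyShift p u)}.Countable :=
  polyShift_mem (countableClusterSeq G) (fun _ (h : Set.Countable _) => h.mono fun _ hl =>
    MapClusterPt.of_comp (tendsto_add_atTop_nat 1) hl) p hu

end ClusterPoints

/-! ### Rationality of θ -/

/-- Sequences that are constant. -/
def constSeq (R M : Type*) [CommRing R] [AddCommGroup M] [Module R M] : Submodule R (ℕ → M) where
  carrier := {u | ∃ a, ∀ k, u k = a}
  add_mem' {u v} := by
    rintro ⟨a, ha⟩ ⟨b, hb⟩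
    exact ⟨a + b, fun k => by simp [ha, hb]⟩
  zero_mem' := ⟨0, by simp⟩
  smul_mem' c u := by
    rintro ⟨a, ha⟩
    exact ⟨c • a, fun k => by simp [ha]⟩

/-- Modulo X - 1, p is the constant p(1); and X - 1 sends k ↦ k t to a constant sequence, which
every further recurrence keeps constant. -/
theorem exists_polyShift_nsmul {M : Type*} [AddCommGroup M] (p : ℤ[X]) (t : M) :
    ∃ c, ∀ k : ℕ, polyShift p (fun k : ℕ => k • t) k = k • (p.eval 1 • t) + c := by
  obtain ⟨q, hq⟩ := X_sub_C_dvd_sub_C_eval (a := (1 : ℤ)) (p := p)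
  have h1 : polyShift (X - C (1 : ℤ)) (fun k : ℕ => k • t) = fun _ => t := by
    ext k
    rw [sub_eq_add_neg, ← C_neg, polyShift_add, polyShift_C_apply, Pi.add_apply,
      polyShift_X_apply]
    simp [add_smul]
  have h2 : polyShift q (fun _ : ℕ => t) ∈ constSeq ℤ M :=
    polyShift_mem (constSeq ℤ M) (fun _ ⟨a, ha⟩ => ⟨a, fun k => ha (k + 1)⟩) q ⟨t, fun _ => rfl⟩
  obtain ⟨c, hc⟩ := h2
  refine ⟨c, fun k => ?_⟩
  have : p = C (p.eval 1) + q * (X - C 1) := by rw [mul_comm, ← hq]; ring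
  conv_lhs => rw [this]
  rw [polyShift_add, polyShift_mul, h1, Pi.add_apply, hc, polyShift_C_apply]
  simp only [Pi.smul_apply]
  rw [smul_comm]

theorem mem_ratModInt_iff {θ : UnitAddCircle} : θ ∈ ratModInt ↔ IsOfFinAddOrder θ := by
  constructor
  · rintro ⟨q, rfl⟩
    exact AddCircle.isOfFinAddOrder_iff_exists_rat_eq_div.2 ⟨q, by simp⟩
  · induction θ using QuotientAddGroup.induction_on with
    | H a =>
      intro h
      obtain ⟨q, hq⟩ := AddCircle.isOfFinAddOrder_iff_exists_rat_eq_div.1 h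
      exact ⟨q, by simp [hq]⟩

theorem not_countable_univ_unitAddCircle : ¬ (Set.univ : Set UnitAddCircle).Countable := by
  intro h
  have : Countable UnitAddCircle := Set.countable_univ_iff.1 h
  have h2 : Countable (Set.Ico (0 : ℝ) (0 + 1)) :=
    (AddCircle.equivIco (1 : ℝ) 0).symm.injective.countable
  have h3 : (Set.Ico (0 : ℝ) (0 + 1)).Countable := h2
  exact (Cardinal.Real.Ico_countable_iff.1 h3).not_gt (by norm_num)

/-- If t had infinite order, its multiples would be dense and every point of the uncountable circle
would be a limit value. -/
theorem isOfFinAddOrder_of_countable_cluster {t c : UnitAddCircle}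
    (h : {l | MapClusterPt l atTop (fun k : ℕ => k • t + c)}.Countable) : IsOfFinAddOrder t := by
  by_contra ht
  refine not_countable_univ_unitAddCircle ((h.image (· - c)).mono fun y _ => ?_)
  have hd : DenseRange (· • t : ℤ → UnitAddCircle) := 
    AddCircle.denseRange_zsmul_iff.2 (addOrderOf_eq_zero_iff.2 ht)
  have hy : MapClusterPt y atTop (fun k : ℕ => k • t) := by
    rw [mapClusterPt_atTop_nsmul_iff_mem_topologicalClosure_zmultiples]
    exact hd y
  refine ⟨y + c, ?_, by simp⟩
  exact hy.tendsto_comp ((continuous_add_const c).tendsto y)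

theorem specCount_subset_ratModInt {x : ℕ → ℝ} {p : ℤ[X]} (hp : p.eval 1 ≠ 0)
    (hx : ∀ᶠ k in atTop, polyShift p x k = 0) : specCount x ⊆ ratModInt := by
  intro θ hθ
  have h1 := polyShift_countable_cluster p hθ
  obtain ⟨c, hc⟩ := exists_polyShift_nsmul p θ
  have hx' : ∀ᶠ k in atTop, polyShift p (fun k => (x k : UnitAddCircle)) k = 0 := by
    filter_upwards [hx] with k hk
    have := polyShift_map (RingHom.id ℤ) (QuotientAddGroup.mk' (AddSubgroup.zmultiples (1 : ℝ)))
      (fun r m => by simp) p x k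
    rw [hk] at this
    simpa using this
  have h2 : polyShift p (fun k => (x k : UnitAddCircle) - k • θ) =ᶠ[atTop]
      fun k => k • (-(p.eval 1 • θ)) + (-c) := by
    filter_upwards [hx'] with k hk
    have : (fun k => (x k : UnitAddCircle) - k • θ) =
      (fun k => (x k : UnitAddCircle)) - fun k : ℕ => k • θ := rfl
    rw [this, map_sub, Pi.sub_apply, hk, hc]
    simp; abel
  have h3 := isOfFinAddOrder_of_countable_cluster (t := -(p.eval 1 • θ)) (c := -c)
    (h1.mono fun l hl => by
      simp only [Set.mem_ofPred_eq, MapClusterPt] at hl ⊢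
      rwa [Filter.map_congr h2])
  rw [mem_ratModInt_iff, isOfFinAddOrder_iff_zsmul_eq_zero]
  rw [isOfFinAddOrder_neg_iff, isOfFinAddOrder_iff_zsmul_eq_zero] at h3
  obtain ⟨n, hn, h⟩ := h3
  exact ⟨n * p.eval 1, mul_ne_zero hn hp, by rwa [mul_smul]⟩

theorem finite_limitValues_iff_of_mem_ratModInt {x : ℕ → ℝ} {θ : UnitAddCircle}
    (hθ : θ ∈ ratModInt) :
    (limitValues x θ).Finite ↔ (fun k => (x k : UnitAddCircle)) ∈ finiteClusterSeq UnitAddCircle := by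
  have hr : (fun k : ℕ => k • θ) ∈ finiteClusterSeq UnitAddCircle := by
    apply mem_finiteClusterSeq_of_finite_range
    rw [mem_ratModInt_iff] at hθ
    have : (AddSubgroup.zmultiples θ : Set UnitAddCircle).Finite := by
      exact hθ.finite_zmultiples
    refine this.subset ?_
    rintro _ ⟨k, rfl⟩
    exact ⟨k, by simp⟩
  have : (limitValues x θ).Finite ↔
    ((fun k => (x k : UnitAddCircle)) - fun k : ℕ => k • θ) ∈
      finiteClusterSeq UnitAddCircle := Iff.rfl
  rw [this]
  exact Submodule.sub_mem_iff_left _ hr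

/-! ### Integer, finitely valued and null parts -/

section Decomposition

theorem tendsto_infDist_of_mapClusterPt {X : Type*} [PseudoMetricSpace X] [CompactSpace X]
    (u : ℕ → X) : Tendsto (fun k => Metric.infDist (u k) {l | MapClusterPt l atTop u}) atTop
      (𝓝 0) := by
  rw [Metric.tendsto_atTop']
  intro η hη
  by_contra hcon
  push Not at hcon
  have hfreq : ∃ᶠ k in atTop, u k ∈ {z | η ≤ Metric.infDist z {l | MapClusterPt l atTop u}} := by
    rw [frequently_atTop']
    intro N
    obtain ⟨k, hk, h⟩ := hcon N
    refine ⟨k, hk, ?_⟩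
    rw [Real.dist_eq, sub_zero, abs_of_nonneg Metric.infDist_nonneg] at h
    exact h
  have hclosed : IsClosed {z : X | η ≤ Metric.infDist z {l | MapClusterPt l atTop u}} :=
    isClosed_le continuous_const (Metric.continuous_infDist_pt _)
  obtain ⟨b, hb, hbc⟩ := hclosed.isCompact.exists_mapClusterPt_of_frequently hfreq
  have h0 : Metric.infDist b {l | MapClusterPt l atTop u} = 0 := Metric.infDist_zero_of_mem hbc
  have hb' : η ≤ Metric.infDist b {l | MapClusterPt l atTop u} := hb
  linarith

/-- Here l_k lifts the limit value nearest to π(x_k), p_k rounds x_k - l_k, and e_k is the signed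
remainder; its absolute value is the distance to the limit set, which tends to 0. -/
theorem exists_int_add_finite_add_null {x : ℕ → ℝ}
    (hx : (fun k => (x k : UnitAddCircle)) ∈ finiteClusterSeq UnitAddCircle) :
    ∃ (p : ℕ → ℤ) (l e : ℕ → ℝ), (Set.range l).Finite ∧ Tendsto e atTop (𝓝 0) ∧
      ∀ k, x k = p k + l k + e k := by
  set L : Set UnitAddCircle := {l | MapClusterPt l atTop (fun k => (x k : UnitAddCircle))}
  have hfin : L.Finite := hx
  have hne : L.Nonempty := exists_clusterPt_of_compactSpace _
  have hex : ∀ k, ∃ y ∈ L, Metric.infDist (x k : UnitAddCircle) L = dist (x k : UnitAddCircle) y :=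
    fun k => hfin.isCompact.exists_infDist_eq_dist hne _
  choose y hyL hy using hex
  let r : UnitAddCircle → ℝ := fun t => Quotient.out t
  have hr : ∀ t, ((r t : ℝ) : UnitAddCircle) = t := fun t => Quotient.out_eq t
  refine ⟨fun k => round (x k - r (y k)), fun k => r (y k),
    fun k => x k - r (y k) - round (x k - r (y k)), ?_, ?_, fun k => by ring⟩
  · refine (hfin.image r).subset ?_
    rintro _ ⟨k, rfl⟩
    exact ⟨y k, hyL k, rfl⟩
  · rw [tendsto_zero_iff_norm_tendsto_zero]
    refine (tendsto_infDist_of_mapClusterPt (fun k => (x k : UnitAddCircle))).congr fun k => ?_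
    rw [Real.norm_eq_abs, ← UnitAddCircle.norm_eq, AddCircle.coe_sub, hr, ← dist_eq_norm]
    exact hy k

theorem exists_norm_bound_of_finite_range {u : ℕ → ℂ} (hu : (Set.range u).Finite) :
    ∃ C, ∀ k, ‖u k‖ ≤ C := by
  obtain ⟨C, hC⟩ := hu.isBounded.exists_norm_le
  exact ⟨C, fun k => hC _ ⟨k, rfl⟩⟩

theorem exists_norm_bound_of_tendsto {u : ℕ → ℂ} (hu : Tendsto u atTop (𝓝 0)) :
    ∃ C, ∀ k, ‖u k‖ ≤ C := by
  obtain ⟨C, hC⟩ := (Metric.isBounded_range_of_tendsto u hu).exists_norm_le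
  exact ⟨C, fun k => hC _ ⟨k, rfl⟩⟩

theorem exists_norm_bound_add {u v : ℕ → ℂ} (hu : (Set.range u).Finite)
    (hv : Tendsto v atTop (𝓝 0)) : ∃ C, ∀ k, ‖(u + v) k‖ ≤ C :=
  boundedSeq.add_mem (exists_norm_bound_of_finite_range hu) (exists_norm_bound_of_tendsto hv)

/-- A null sequence with values in `ℤ + V`, with `V` finite, vanishes eventually. -/
theorem eventually_eq_zero_of_int_add_finite {n : ℕ → ℤ} {v : ℕ → ℂ}
    (hv : (Set.range v).Finite) (h : Tendsto (fun k => (n k : ℂ) + v k) atTop (𝓝 0)) :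
    ∀ᶠ k in atTop, (n k : ℂ) + v k = 0 := by
  obtain ⟨C, hC⟩ := exists_norm_bound_of_finite_range hv
  obtain ⟨D, hD⟩ := exists_norm_bound_of_tendsto h
  obtain ⟨B, hB⟩ := exists_nat_ge (C + D)
  -- Boundedness confines all terms to a finite set, in which 0 is isolated.
  let T : Set ℂ := Set.image2 (fun (m : ℤ) (z : ℂ) => (m : ℂ) + z) (Set.Icc (-B) B) (Set.range v)
  have hT : (T \ {0}).Finite := ((Set.finite_Icc _ _).image2 _ hv).sdiff
  have hmem : ∀ k, (n k : ℂ) + v k ∈ T := by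
    intro k
    refine ⟨n k, ?_, v k, ⟨k, rfl⟩, rfl⟩
    have h1 : ‖(n k : ℂ)‖ ≤ B := by
      calc ‖(n k : ℂ)‖ = ‖((n k : ℂ) + v k) - v k‖ := by ring_nf
        _ ≤ ‖(n k : ℂ) + v k‖ + ‖v k‖ := norm_sub_le _ _
        _ ≤ B := by linarith [hC k, hD k]
    rw [Complex.norm_intCast] at h1
    have h2 : |n k| ≤ B := by exact_mod_cast h1
    exact abs_le.1 h2
  have hnhds : (T \ {0})ᶜ ∈ 𝓝 (0 : ℂ) := hT.isClosed.isOpen_compl.mem_nhds (by simp)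
  filter_upwards [h hnhds] with k hk
  by_contra hne
  exact hk ⟨hmem k, hne⟩

end Decomposition

/-! ### Rational recurrences for the non-null part -/

theorem exists_int_polynomial_map_eq (P : ℚ[X]) :
    ∃ (b : ℤ) (S : ℤ[X]), b ≠ 0 ∧ S.map (Int.castRingHom ℚ) = C (b : ℚ) * P := by
  obtain ⟨b, hb0, hb⟩ := IsLocalization.integerNormalization_spec (nonZeroDivisors ℤ) P
  refine ⟨b, _, nonZeroDivisors.ne_zero hb0, hb.trans ?_⟩
  rw [← Polynomial.smul_eq_C_mul]
  ext n
  simp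

theorem polyShift_ratMap_apply (p : ℚ[X]) (u : ℕ → ℂ) (k : ℕ) :
    polyShift (p.map (algebraMap ℚ ℂ)) u k = polyShift p u k :=
  polyShift_map (algebraMap ℚ ℂ) (AddMonoidHom.id ℂ) (fun r m => by simp [Rat.smul_def]) p u k

/-- S(E)(p + l) is an integer sequence plus a finitely valued one, and it equals the null sequence
-S(E)e. -/
theorem polyShift_intMap_eventually_eq_zero {p : ℕ → ℤ} {l e : ℕ → ℂ}
    (hl : (Set.range l).Finite) (he : Tendsto e atTop (𝓝 0)) (S : ℤ[X])
    (h : polyShift (S.map (Int.castRingHom ℂ)) (fun k => (p k : ℂ) + l k + e k) = 0) :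
    ∀ᶠ k in atTop, polyShift (S.map (Int.castRingHom ℂ)) (fun k => (p k : ℂ) + l k) k = 0 := by
  set T := S.map (Int.castRingHom ℂ)
  have h1 : ∀ k, polyShift T (fun k => (p k : ℂ)) k = ((polyShift S p k : ℤ) : ℂ) := fun k =>
    polyShift_map (Int.castRingHom ℂ) (Int.castAddHom ℂ) (fun r m => by simp) S p k
  have h2 : ∀ k, polyShift T (fun k => (p k : ℂ) + l k) k =
      ((polyShift S p k : ℤ) : ℂ) + polyShift T l k := by
    intro k
    have : (fun k => (p k : ℂ) + l k) = (fun k => (p k : ℂ)) + l := rfl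
    rw [this, map_add, Pi.add_apply, h1]
  have h3 : polyShift T (fun k => (p k : ℂ) + l k) = -polyShift T e := by
    have : (fun k => (p k : ℂ) + l k + e k) = (fun k => (p k : ℂ) + l k) + e := rfl
    rw [this, map_add] at h
    exact eq_neg_of_add_eq_zero_left h
  have h4 : Tendsto (polyShift T (fun k => (p k : ℂ) + l k)) atTop (𝓝 0) := by
    rw [h3]
    simpa using! (polyShift_tendsto_zero T he).neg
  simp_rw [h2]
  exact eventually_eq_zero_of_int_add_finite (polyShift_finite_range T hl)
    (h4.congr h2)

/-- Replacing the finitely many fractional parts by rational numbers in a way compatible with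
rational linear recurrences. -/
theorem exists_rational_add_finite {p : ℕ → ℤ} {l e : ℕ → ℂ}
    (hl : (Set.range l).Finite) (he : Tendsto e atTop (𝓝 0)) (P : ℚ[X])
    (h : polyShift (P.map (algebraMap ℚ ℂ)) (fun k => (p k : ℂ) + l k + e k) = 0) :
    ∃ (q : ℕ → ℚ) (w : ℕ → ℂ) (N : Submodule ℤ ℂ), (Set.range w).Finite ∧ N.FG ∧
      (∀ k, (q k : ℂ) ∈ N) ∧ (∀ k, (p k : ℂ) + l k + e k = q k + w k + e k) ∧
      ∀ᶠ k in atTop, polyShift P q k = 0 := by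
  obtain ⟨b, S, hb, hS⟩ := exists_int_polynomial_map_eq P
  have hSC : S.map (Int.castRingHom ℂ) = C (b : ℂ) * P.map (algebraMap ℚ ℂ) := by
    have := congrArg (Polynomial.map (algebraMap ℚ ℂ)) hS
    rw [Polynomial.map_map] at this
    rw [show Int.castRingHom ℂ = (algebraMap ℚ ℂ).comp (Int.castRingHom ℚ) from
      RingHom.ext_int _ _, this]
    simp
  have h1 := polyShift_intMap_eventually_eq_zero hl he S
    (by rw [hSC, polyShift_mul, h, map_zero])
  have h2 : ∀ᶠ k in atTop, polyShift P (fun k => (p k : ℂ) + l k) k = 0 := by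
    filter_upwards [h1] with k hk
    rw [hSC, polyShift_mul, polyShift_C_apply, Pi.smul_apply, polyShift_ratMap_apply] at hk
    simpa [hb] using hk
  -- φ is a ℚ-linear retraction of ℂ onto ℚ: it fixes p and commutes with P(E).
  obtain ⟨φ, hφ⟩ := (Algebra.linearMap ℚ ℂ).exists_leftInverse_of_injective
    (LinearMap.ker_eq_bot.2 (algebraMap ℚ ℂ).injective)
  have hφq : ∀ r : ℚ, φ (r : ℂ) = r := fun r => LinearMap.congr_fun hφ r
  have hφz : ∀ r : ℤ, φ (r : ℂ) = r := fun r => by simpa using hφq r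
  refine ⟨fun k => φ (p k + l k), fun k => l k - φ (l k),
    Submodule.span ℤ (insert 1 ((fun z : ℂ => (φ z : ℂ)) '' Set.range l)), ?_, ?_, ?_, ?_, ?_⟩
  · refine (hl.image fun z => z - (φ z : ℂ)).subset ?_
    rintro _ ⟨k, rfl⟩
    exact ⟨l k, ⟨k, rfl⟩, rfl⟩
  · exact Submodule.fg_span ((hl.image _).insert _)
  · intro k
    simp only [map_add, hφz]
    push_cast
    refine Submodule.add_mem _ ?_ (Submodule.subset_span (Or.inr ⟨l k, ⟨k, rfl⟩, rfl⟩))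
    have : (p k : ℂ) = p k • (1 : ℂ) := by simp
    rw [this]
    exact Submodule.smul_mem _ _ (Submodule.subset_span (Or.inl rfl))
  · intro k
    simp only [map_add, hφz]
    push_cast
    ring
  · filter_upwards [h2] with k hk
    have := polyShift_map (RingHom.id ℚ) φ.toAddMonoidHom (fun r m => by simp) P
      (fun k => (p k : ℂ) + l k) k
    rw [hk] at this
    simpa using this

/-! ### Growth of exponential polynomials -/

section Growth

/-- Pigeonhole: among m + 1 late indices two share a value of w, so c b^k nearly repeats after at
most m steps. If b is not a root of unity, |b^n - 1| is bounded below for these n. -/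
theorem exists_pow_eq_one_of_finite_add_null {b c : ℂ} (hb : ‖b‖ = 1) (hc : c ≠ 0)
    {w e : ℕ → ℂ} (hw : (Set.range w).Finite) (he : Tendsto e atTop (𝓝 0))
    (h : ∀ k, c * b ^ k = w k + e k) : ∃ n : ℕ, 0 < n ∧ b ^ n = 1 := by
  by_contra! hcon
  set m := hw.toFinset.card
  have hm : (Finset.Icc 1 (m + 1)).Nonempty := ⟨1, by simp⟩
  obtain ⟨n₀, hn₀, hmin⟩ := Finset.exists_min_image (Finset.Icc 1 (m + 1))
    (fun n => ‖b ^ n - 1‖) hm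
  have hpos : 0 < ‖c‖ * ‖b ^ n₀ - 1‖ := mul_pos (norm_pos_iff.2 hc) (norm_pos_iff.2
    (sub_ne_zero.2 (hcon n₀ (Finset.mem_Icc.1 hn₀).1)))
  obtain ⟨N, hN⟩ := Metric.tendsto_atTop.1 he _ (half_pos hpos)
  have key : ∀ i j, i < j → j < m + 1 → w (N + i) ≠ w (N + j) := by
    intro i j hij hj hwij
    have h1 : c * b ^ (N + i) * (b ^ (j - i) - 1) = e (N + j) - e (N + i) := by
      have hp : b ^ (N + j) = b ^ (N + i) * b ^ (j - i) := by
        rw [← pow_add]; congr 1; omega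
      have h3 := h (N + j)
      rw [hp] at h3
      linear_combination h3 - h (N + i) - hwij
    have h2 := congrArg norm h1
    rw [norm_mul, norm_mul, norm_pow, hb, one_pow, mul_one] at h2
    have h3 := hmin (j - i) (Finset.mem_Icc.2 ⟨by omega, by omega⟩)
    have h4 := norm_sub_le (e (N + j)) (e (N + i))
    have h5 := hN (N + j) (by omega)
    have h6 := hN (N + i) (by omega)
    rw [dist_zero_right] at h5 h6
    have h7 := mul_le_mul_of_nonneg_left h3 (norm_nonneg c)
    linarith
  obtain ⟨i, hi, j, hj, hij, hwij⟩ := Finset.exists_ne_map_eq_of_card_lt_of_maps_to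
    (s := Finset.range (m + 1)) (t := hw.toFinset) (f := fun i => w (N + i))
    (by simp [m]) (by intro i _; simp)
  rw [Finset.mem_range] at hi hj
  rcases lt_or_gt_of_ne hij with h1 | h1
  · exact key i j h1 hj hwij
  · exact key j i h1 hi hwij.symm

/-- The right side is bounded. For |b| > 1 this makes the left side eventually zero, against G ≠ 0;
for |b| = 1 it makes G constant. -/
theorem norm_lt_one_or_exists_pow_eq_one {G : ℂ[X]} (hG : G ≠ 0) {b : ℂ} {w e : ℕ → ℂ}
    (hw : (Set.range w).Finite) (he : Tendsto e atTop (𝓝 0))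
    (h : ∀ k : ℕ, G.eval (k : ℂ) * b ^ k = w k + e k) :
    ‖b‖ < 1 ∨ ∃ n : ℕ, 0 < n ∧ b ^ n = 1 := by
  have hfun : (fun k : ℕ => G.eval (k : ℂ) * b ^ k) = w + e := funext h
  have hbd := exists_norm_bound_add hw he
  rcases lt_trichotomy ‖b‖ 1 with h1 | h1 | h1
  · exact Or.inl h1
  · right
    by_cases hd : 0 < G.degree
    · exfalso
      have ht := G.tendsto_norm_atTop hd (l := atTop) (z := fun k : ℕ => (k : ℂ)) (by
        simpa using tendsto_natCast_atTop_atTop (R := ℝ))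
      obtain ⟨C, hC⟩ := hbd
      obtain ⟨k, hk⟩ := (ht.eventually_gt_atTop C).exists
      have := hC k
      rw [← hfun] at this
      simp only [norm_mul, norm_pow, h1, one_pow, mul_one] at this
      linarith
    · obtain ⟨c, rfl⟩ : ∃ c, G = C c := ⟨_, eq_C_of_degree_le_zero (not_lt.1 hd)⟩
      refine exists_pow_eq_one_of_finite_add_null h1 (by simpa using hG) hw he ?_
      simpa using h
  · exfalso
    have hz := eventually_eq_zero_of_bounded h1 (G.natDegree + 1) hbd (by
      rw [← hfun, polyShift_X_sub_C_pow_eval_mul_pow b (G.natDegree + 1)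
        (degree_le_natDegree.trans_lt (by exact_mod_cast Nat.lt_succ_self _))]
      simp)
    rw [← hfun] at hz
    have hb0 : b ≠ 0 := by rintro rfl; simp at h1; linarith
    obtain ⟨N, hN⟩ := eventually_atTop.1 hz
    refine hG (eq_of_infinite_eval_eq _ _ (((Set.Ici_infinite N).image
      (Nat.cast_injective (R := ℂ)).injOn).mono ?_))
    rintro _ ⟨k, hk, rfl⟩
    simpa [hb0] using hN k hk

end Growth

/-! ### Necessity of the Pisot condition -/

/-- Over a field containing a root `t` of a separable polynomial `P`, the projector onto the
`t`-part of the solutions of the recurrence `P ^ n`. -/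
theorem exists_projector {K : Type*} [Field K] {P : K[X]} (hP : P.Separable) {t : K}
    (ht : P.IsRoot t) (n : ℕ) :
    ∃ A Q : K[X], P = (X - C t) * Q ∧ (X - C t) ^ n ∣ 1 - A ∧ Q ^ n ∣ A ∧
      P ^ n ∣ (X - C t) ^ n * A := by
  obtain ⟨Q, hQ⟩ := dvd_iff_isRoot.2 ht
  have hcop : IsCoprime ((X - C t) ^ n) (Q ^ n) := by
    rw [hQ] at hP
    exact hP.isCoprime.pow
  obtain ⟨U, V, hUV⟩ := hcop
  -- From the Bézout relation U (X - t)^n + V Q^n = 1.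
  refine ⟨V * Q ^ n, Q, hQ, ⟨U, ?_⟩, ⟨V, mul_comm _ _⟩, ⟨V, ?_⟩⟩
  · linear_combination -hUV
  · rw [hQ, mul_pow]
    ring

theorem fg_polyShift_values (p : ℂ[X]) {q : ℕ → ℂ} (N : Submodule ℤ ℂ) (hN : N.FG)
    (hq : ∀ k, q k ∈ N) : ∃ M : Submodule ℤ ℂ, M.FG ∧ ∀ k, polyShift p q k ∈ M := by
  refine ⟨⨆ i ∈ Finset.range (p.natDegree + 1), N.map (LinearMap.mulLeft ℤ (p.coeff i)),
    Submodule.fg_biSup _ _ fun i _ => hN.map _, fun k => ?_⟩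
  rw [polyShift_apply_eq_sum]
  refine Submodule.sum_mem _ fun i hi => ?_
  exact (le_iSup₂_of_le (f := fun i (_ : i ∈ Finset.range (p.natDegree + 1)) =>
    N.map (LinearMap.mulLeft ℤ (p.coeff i))) i hi le_rfl) ⟨q (k + i), hq _, rfl⟩

theorem polyShift_map_ratCast {K L : Type*} [Field K] [Field L] [CharZero K] [CharZero L]
    (f : K →+* L) (p : K[X]) (q : ℕ → ℚ) (k : ℕ) :
    polyShift (p.map f) (fun k => (q k : L)) k = f (polyShift p (fun k => (q k : K)) k) := by
  have := polyShift_map f f.toAddMonoidHom (fun r m => by simp) p (fun k => (q k : K)) k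
  simpa using this

theorem polyShift_dvd_eventually_eq_zero {R M : Type*} [CommRing R] [AddCommGroup M] [Module R M]
    {p q : R[X]} (h : p ∣ q) {u : ℕ → M} (hu : ∀ᶠ k in atTop, polyShift p u k = 0) :
    ∀ᶠ k in atTop, polyShift q u k = 0 := by
  obtain ⟨r, rfl⟩ := h
  rw [mul_comm, polyShift_mul]
  exact polyShift_eventually_eq_zero r hu

theorem pisot_of_finite_fractional_parts {a : ℂ} (ha : 1 < ‖a‖) (hint : IsIntegral ℚ a) {F : ℂ[X]}
    (hF : F ≠ 0) {p : ℕ → ℤ} {l e : ℕ → ℂ} (hl : (Set.range l).Finite)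
    (he : Tendsto e atTop (𝓝 0)) (hx : ∀ k : ℕ, F.eval (k : ℂ) * a ^ k = p k + l k + e k) :
    IsIntegral ℤ a ∧ (∀ z, IsConjRoot ℚ a z → z ≠ a → ‖z‖ < 1) ∧ ∀ n, F.coeff n ∈ ℚ⟮a⟯ := by
  have ha0 : a ≠ 0 := by rintro rfl; simp at ha; linarith
  set n := F.natDegree + 1
  have hdeg : F.degree < n := degree_le_natDegree.trans_lt (by exact_mod_cast Nat.lt_succ_self _)
  set P := minpoly ℚ a
  have hsep : P.Separable := (minpoly.irreducible hint).separable
  have hPn : polyShift ((P ^ n).map (algebraMap ℚ ℂ)) (fun k : ℕ => F.eval (k : ℂ) * a ^ k) = 0 := by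
    refine polyShift_eval_mul_pow_of_dvd hdeg ?_
    rw [Polynomial.map_pow]
    refine pow_dvd_pow_of_dvd (dvd_iff_isRoot.2 ?_) n
    rw [IsRoot.def, eval_map_algebraMap, minpoly.aeval]
  obtain ⟨q, w, N, hw, hN, hqN, hsum, hq⟩ := exists_rational_add_finite hl he (P ^ n)
    (by simpa only [hx] using hPn)
  replace hsum : ∀ k : ℕ, F.eval (k : ℂ) * a ^ k = q k + w k + e k :=
    fun k => (hx k).trans (hsum k)
  have hfun : (fun k : ℕ => F.eval (k : ℂ) * a ^ k) = (fun k => (q k : ℂ)) + (w + e) := by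
    ext k; rw [hsum]; simp [add_assoc]
  set K := ℚ⟮a⟯
  set t : K := AdjoinSimple.gen ℚ a
  have htroot : (P.map (algebraMap ℚ K)).IsRoot t := by
    rw [IsRoot.def, eval_map_algebraMap]
    exact IntermediateField.aeval_gen_minpoly ℚ a
  obtain ⟨A, Q, hQ, hA1, hA2, hA3⟩ := exists_projector (hsep.map (f := algebraMap ℚ K)) htroot n
  have hqK : ∀ᶠ k in atTop, polyShift ((X - C t) ^ n * A) (fun k => (q k : K)) k = 0 := by
    refine polyShift_dvd_eventually_eq_zero hA3 ?_
    filter_upwards [hq] with k hk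
    rw [← Polynomial.map_pow]
    have := polyShift_map_ratCast (algebraMap ℚ K) (P ^ n) q k
    rw [this]
    simpa using hk
  have hqσ : ∀ (σ : K →+* ℂ), ∀ᶠ k in atTop,
      polyShift ((X - C (σ t)) ^ n * A.map σ) (fun k => (q k : ℂ)) k = 0 := by
    intro σ
    filter_upwards [hqK] with k hk
    have := polyShift_map_ratCast σ ((X - C t) ^ n * A) q k
    rw [hk] at this
    simpa using this
  set ι : K →+* ℂ := algebraMap K ℂ
  have hιt : ι t = a := AdjoinSimple.algebraMap_gen ℚ a
  have hbdd := exists_norm_bound_add hw he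
  have hfix : polyShift (A.map ι) (fun k : ℕ => F.eval (k : ℂ) * a ^ k) =
      fun k : ℕ => F.eval (k : ℂ) * a ^ k := by
    have h1 : (X - C a) ^ n ∣ 1 - A.map ι := by
      have := Polynomial.map_dvd ι hA1
      simpa [hιt] using this
    have h2 := polyShift_eval_mul_pow_of_dvd hdeg h1
    have h3 : (1 : ℂ[X]) = (1 - A.map ι) + A.map ι := by ring
    conv_rhs => rw [← polyShift_one (R := ℂ) (fun k : ℕ => F.eval (k : ℂ) * a ^ k), h3,
      polyShift_add, h2, zero_add]
  -- (E - a)^n A(E) kills x, and eventually q, hence eventually w + e as well; bounded solutions of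
  -- (E - a)^n vanish eventually.
  have hδ : ∀ᶠ k in atTop, polyShift (A.map ι) (w + e) k = 0 := by
    refine eventually_eq_zero_of_bounded ha n (polyShift_bounded _ hbdd) ?_
    have h1 := hqσ ι
    rw [hιt] at h1
    have h2 := polyShift_X_sub_C_pow_eval_mul_pow a n hdeg
    rw [← hfix, ← polyShift_mul, hfun, map_add] at h2
    filter_upwards [h1] with k hk
    have h3 := congrFun h2 k
    rw [Pi.add_apply, hk, zero_add] at h3
    rw [← polyShift_mul]
    exact h3
  have hev : ∀ᶠ k : ℕ in atTop, F.eval (k : ℂ) * a ^ k =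
      ι (polyShift A (fun k => (q k : K)) k) := by
    filter_upwards [hδ] with k hk
    have h1 := congrFun hfix k
    rw [hfun, map_add, Pi.add_apply, hk, add_zero, polyShift_map_ratCast] at h1
    exact h1.symm
  obtain ⟨G, hG⟩ := exists_map_eq_of_eventually_eval_mem ι F (by
    filter_upwards [hev] with k hk
    refine ⟨polyShift A (fun k => (q k : K)) k * (t ^ k)⁻¹, ?_⟩
    rw [map_mul, ← hk, map_inv₀, map_pow, hιt]
    field_simp)
  have hG0 : G ≠ 0 := by rintro rfl; exact hF (by simp [← hG])
  have hGev : ∀ᶠ k : ℕ in atTop, G.eval (k : K) * t ^ k = polyShift A (fun k => (q k : K)) k := by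
    filter_upwards [hev] with k hk
    apply ι.injective
    rw [← hk, map_mul, map_pow, hιt, ← hG, ← eval_map_apply, map_natCast]
  refine ⟨?_, ?_, ?_⟩
  · obtain ⟨M, hM, hmem⟩ := fg_polyShift_values (A.map ι) N hN hqN
    refine isIntegral_of_eval_mul_pow_mem ha0 hF M hM ?_
    filter_upwards [hev] with k hk
    rw [hk, ← polyShift_map_ratCast]
    exact hmem k
  · intro z hz hza
    have hzP : aeval z P = 0 := hz.aeval_eq_zero
    let σ : K →ₐ[ℚ] ℂ := (adjoin.powerBasis hint).lift z (by
      rw [adjoin.powerBasis_gen, minpoly_gen]; exact hzP)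
    have hσt : σ t = z := by
      have := (adjoin.powerBasis hint).lift_gen z (by
        rw [adjoin.powerBasis_gen, minpoly_gen]; exact hzP)
      exact (congrArg σ (adjoin.powerBasis_gen hint)).symm.trans this
    set τ : K →+* ℂ := σ.toRingHom
    have hτt : τ t = z := hσt
    -- As z ≠ a, the root a of P is a root of Q^τ, so A^τ(E) kills x.
    have hdvd : (X - C a) ^ n ∣ A.map τ := by
      refine dvd_trans (pow_dvd_pow_of_dvd (dvd_iff_isRoot.2 ?_) n)
        (by simpa using Polynomial.map_dvd τ hA2)
      have h1 := congrArg (fun r => (r.map τ).eval a) hQ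
      simp only [Polynomial.map_map, Polynomial.map_mul, Polynomial.map_sub, map_X, map_C, hτt,
        eval_mul, eval_sub, eval_X, eval_C] at h1
      rw [show τ.comp (algebraMap ℚ K) = algebraMap ℚ ℂ from RingHom.ext_rat _ _,
        eval_map_algebraMap, minpoly.aeval] at h1
      exact (mul_eq_zero.1 h1.symm).resolve_left (sub_ne_zero.2 hza.symm)
    have h1 : polyShift (A.map τ) (fun k => (q k : ℂ)) =
        -polyShift (A.map τ) w - polyShift (A.map τ) e := by
      have := polyShift_eval_mul_pow_of_dvd hdeg hdvd
      rw [hfun, map_add, map_add] at this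
      linear_combination this
    have hGτ : G.map τ ≠ 0 := (Polynomial.map_ne_zero_iff τ.injective).2 hG0
    have hGτev : ∀ᶠ k : ℕ in atTop, (G.map τ).eval (k : ℂ) * z ^ k =
        (-polyShift (A.map τ) w - polyShift (A.map τ) e) k := by
      filter_upwards [hGev] with k hk
      rw [← h1, polyShift_map_ratCast, ← hk, map_mul, map_pow, hτt, ← eval_map_apply, map_natCast]
    have hfin : (Set.range (-polyShift (A.map τ) w)).Finite :=
      (finiteRangeSeq ℂ ℂ).neg_mem (polyShift_finite_range _ hw)
    have hnull : Tendsto (fun k : ℕ => (G.map τ).eval (k : ℂ) * z ^ k -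
        (-polyShift (A.map τ) w) k) atTop (𝓝 0) := by
      have h2 : Tendsto (-polyShift (A.map τ) e) atTop (𝓝 0) := by
        simpa using! (polyShift_tendsto_zero (A.map τ) he).neg
      refine h2.congr' ?_
      filter_upwards [hGτev] with k hk
      rw [hk]
      simp
      ring
    rcases norm_lt_one_or_exists_pow_eq_one (b := z) hGτ hfin hnull
      (fun k => by ring) with h | ⟨m, hm, hzm⟩
    · exact h
    · exfalso
      -- If the conjugate z is a root of unity, so is a, against |a| > 1.
      have h2 : P ∣ X ^ m - 1 := by
        rw [show P = minpoly ℚ z from hz]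
        exact minpoly.dvd _ _ (by simp [hzm])
      have h3 : a ^ m = 1 := by
        have := aeval_eq_zero_of_dvd_aeval_eq_zero h2 (minpoly.aeval ℚ a)
        simpa [sub_eq_zero] using this
      have h4 := congrArg norm h3
      rw [norm_pow, norm_one] at h4
      exact absurd h4 (one_lt_pow₀ ha hm.ne').ne'
  · intro i
    rw [← hG, coeff_map]
    exact (G.coeff i).2

/-! ### Sufficiency of the Pisot condition -/

theorem finite_range_intCast_div (n : ℕ → ℤ) (D : ℤ) :
    (Set.range fun k => (((n k : ℝ) / D : ℝ) : UnitAddCircle)).Finite := by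
  have hfin : IsOfFinAddOrder (((1 / D : ℝ)) : UnitAddCircle) :=
    mem_ratModInt_iff.1 ⟨1 / D, by simp⟩
  refine hfin.finite_zmultiples.subset ?_
  rintro _ ⟨k, rfl⟩
  refine ⟨n k, ?_⟩
  simp only [← AddCircle.coe_zsmul, zsmul_eq_mul]
  congr 1
  ring

theorem tendsto_natCast_pow_mul_pow_zero (j : ℕ) {z : ℂ} (hz : ‖z‖ < 1) :
    Tendsto (fun k : ℕ => (k : ℂ) ^ j * z ^ k) atTop (𝓝 0) := by
  rw [tendsto_zero_iff_norm_tendsto_zero]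
  simpa using tendsto_pow_const_mul_const_pow_of_abs_lt_one j (r := ‖z‖) (by simpa using hz)

theorem exists_int_trace {K : Type*} [Field K] [Algebra ℚ K] [FiniteDimensional ℚ K] {y : K}
    (hy : IsIntegral ℤ y) : ∃ n : ℤ, (n : ℂ) = ∑ σ : K →ₐ[ℚ] ℂ, σ y := by
  obtain ⟨n, hn⟩ := IsIntegrallyClosed.isIntegral_iff.1 (Algebra.isIntegral_trace (L := ℚ) hy)
  refine ⟨n, ?_⟩
  rw [← trace_eq_sum_embeddings ℂ, ← hn]
  simp

-- D clears the denominator of c, so the trace n_k of D c α^k is an integer. The embeddings other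
-- than the inclusion contribute k^j σ(α)^k with |σ(α)| < 1, which tends to 0.
open scoped Classical in
theorem monomial_mem_finiteClusterSeq {α : ℝ} (hint : IsIntegral ℤ (α : ℂ))
    (hconj : ∀ z, IsConjRoot ℚ (α : ℂ) z → z ≠ α → ‖z‖ < 1) {c : ℝ}
    (hc : (c : ℂ) ∈ ℚ⟮(α : ℂ)⟯) (j : ℕ) :
    (fun k : ℕ => ((c * (k : ℝ) ^ j * α ^ k : ℝ) : UnitAddCircle)) ∈
      finiteClusterSeq UnitAddCircle := by
  have hintQ : IsIntegral ℚ (α : ℂ) := hint.tower_top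
  set K := ℚ⟮(α : ℂ)⟯
  have : FiniteDimensional ℚ K := adjoin.finiteDimensional hintQ
  set t : K := AdjoinSimple.gen ℚ (α : ℂ)
  have htint : IsIntegral ℤ t := by
    refine (isIntegral_algebraMap_iff (algebraMap K ℂ).injective).1 ?_
    exact hint
  set c' : K := ⟨c, hc⟩
  obtain ⟨D, hD, hDint⟩ := ((IsFractionRing.isAlgebraic_iff ℤ ℚ K).2
    (Algebra.IsAlgebraic.isAlgebraic (R := ℚ) c')).exists_integral_multiple
  have hex : ∀ k : ℕ, ∃ n : ℤ, (n : ℂ) = ∑ σ : K →ₐ[ℚ] ℂ, σ (D • c' * t ^ k) :=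
    fun k => exists_int_trace (hDint.mul (htint.pow k))
  choose n hn using hex
  obtain ⟨σ₀, hσ₀⟩ : ∃ σ₀ : K →ₐ[ℚ] ℂ, ∀ y : K, σ₀ y = y :=
    ⟨(algebraMap K ℂ).toRatAlgHom, fun _ => rfl⟩
  have hD0 : (D : ℝ) ≠ 0 := by exact_mod_cast hD
  have hD0' : (D : ℂ) ≠ 0 := by exact_mod_cast hD
  have hsplit : ∀ k : ℕ, (D : ℂ) * c * α ^ k =
      n k - ∑ σ ∈ Finset.univ.erase σ₀, σ (D • c') * σ t ^ k := by
    intro k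
    rw [hn, ← Finset.add_sum_erase Finset.univ (fun σ : K →ₐ[ℚ] ℂ => σ (D • c' * t ^ k))
      (Finset.mem_univ σ₀)]
    have h1 : σ₀ (D • c' * t ^ k) = D * c * α ^ k := by
      rw [map_mul, map_pow, map_zsmul, zsmul_eq_mul, hσ₀, hσ₀]
      rfl
    rw [h1]
    simp
  have hsmall : ∀ σ ∈ Finset.univ.erase σ₀, ‖σ t‖ < 1 := by
    intro σ hσ
    refine hconj _ ?_ fun h => (Finset.mem_erase.1 hσ).1 ?_
    · refine isConjRoot_of_aeval_eq_zero hintQ ?_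
      have := congrArg σ (aeval_gen_minpoly ℚ (α : ℂ))
      rwa [← aeval_algHom_apply, map_zero] at this
    · refine (adjoin.powerBasis hintQ).algHom_ext ?_
      rw [adjoin.powerBasis_gen]
      exact h.trans (hσ₀ t).symm
  let e : ℕ → ℝ := fun k => c * (k : ℝ) ^ j * α ^ k - ((n k * (k : ℤ) ^ j : ℤ) : ℝ) / D
  have he : Tendsto e atTop (𝓝 0) := by
    have h1 : Tendsto (fun k : ℕ => ∑ σ ∈ Finset.univ.erase σ₀,
        (-(D : ℂ)⁻¹ * σ (D • c')) * ((k : ℂ) ^ j * σ t ^ k)) atTop (𝓝 0) := by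
      have := tendsto_finsetSum (Finset.univ.erase σ₀) fun σ hσ =>
        (tendsto_natCast_pow_mul_pow_zero j (hsmall σ hσ)).const_mul (-(D : ℂ)⁻¹ * σ (D • c'))
      simpa using this
    have h2 : ∀ k : ℕ, ∑ σ ∈ Finset.univ.erase σ₀,
        (-(D : ℂ)⁻¹ * σ (D • c')) * ((k : ℂ) ^ j * σ t ^ k) = ((e k : ℝ) : ℂ) := by
      intro k
      have h3 : ∑ σ ∈ Finset.univ.erase σ₀,
          (-(D : ℂ)⁻¹ * σ (D • c')) * ((k : ℂ) ^ j * σ t ^ k) =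
          -(D : ℂ)⁻¹ * (k : ℂ) ^ j * ∑ σ ∈ Finset.univ.erase σ₀, σ (D • c') * σ t ^ k := by
        rw [Finset.mul_sum]
        exact Finset.sum_congr rfl fun σ _ => by ring
      have h4 : ∑ σ ∈ Finset.univ.erase σ₀, σ (D • c') * σ t ^ k =
          n k - (D : ℂ) * c * α ^ k := by rw [hsplit]; ring
      rw [h3, h4]
      simp only [e]
      push_cast
      field_simp
      ring
    simp_rw [h2] at h1
    exact tendsto_ofReal_iff.1 (by simpa using h1)
  have hdec : (fun k : ℕ => ((c * (k : ℝ) ^ j * α ^ k : ℝ) : UnitAddCircle)) =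
      (fun k => ((((n k * (k : ℤ) ^ j : ℤ) : ℝ) / D : ℝ) : UnitAddCircle)) +
        fun k => ((e k : ℝ) : UnitAddCircle) := by
    ext k
    rw [Pi.add_apply, ← AddCircle.coe_add]
    simp [e]
  rw [hdec]
  refine Submodule.add_mem _ (mem_finiteClusterSeq_of_finite_range
    (finite_range_intCast_div (fun k => n k * (k : ℤ) ^ j) D)) (mem_finiteClusterSeq_of_tendsto
    (a := ((0 : ℝ) : UnitAddCircle)) ?_)
  exact ((AddCircle.continuous_mk' (1 : ℝ)).tendsto 0).comp he

theorem eval_mul_pow_mem_finiteClusterSeq {α : ℝ} (hint : IsIntegral ℤ (α : ℂ))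
    (hconj : ∀ z, IsConjRoot ℚ (α : ℂ) z → z ≠ α → ‖z‖ < 1) {F : ℝ[X]}
    (hF : ∀ n, (F.coeff n : ℂ) ∈ ℚ⟮(α : ℂ)⟯) :
    (fun k : ℕ => ((F.eval (k : ℝ) * α ^ k : ℝ) : UnitAddCircle)) ∈
      finiteClusterSeq UnitAddCircle := by
  have : (fun k : ℕ => ((F.eval (k : ℝ) * α ^ k : ℝ) : UnitAddCircle)) =
      ∑ i ∈ Finset.range (F.natDegree + 1),
        fun k : ℕ => ((F.coeff i * (k : ℝ) ^ i * α ^ k : ℝ) : UnitAddCircle) := by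
    ext k
    rw [Finset.sum_apply, eval_eq_sum_range, Finset.sum_mul]
    exact map_sum (QuotientAddGroup.mk' (AddSubgroup.zmultiples (1 : ℝ))) _ _
  rw [this]
  exact Submodule.sum_mem _ fun i _ => monomial_mem_finiteClusterSeq hint hconj (hF i) i

/-! ### Passage between ℝ and ℂ, and conclusion -/

theorem isIntegral_ofReal_iff {α : ℝ} : IsIntegral ℤ (α : ℂ) ↔ IsIntegral ℤ α :=
  isIntegral_algebraMap_iff (A := ℝ) (B := ℂ) Complex.ofReal_injective

/-- For negative α, z ↦ -z exchanges the conjugates of α and of |α|. -/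
theorem isPisot_abs_iff {α : ℝ} (hα : 1 < |α|) :
    IsPisot |α| ↔ IsIntegral ℤ (α : ℂ) ∧ ∀ z, IsConjRoot ℚ (α : ℂ) z → z ≠ α → ‖z‖ < 1 := by
  rw [isIntegral_ofReal_iff, IsPisot]
  rcases abs_choice α with h | h
  · rw [h] at hα ⊢
    simp [hα]
  · rw [h] at hα ⊢
    have h1 : IsIntegral ℤ (-α) ↔ IsIntegral ℤ α :=
      ⟨fun h => by simpa using h.neg, fun h => h.neg⟩
    rw [h1]
    simp only [hα, true_and]
    refine and_congr_right fun _ => ⟨fun H z hz hne => ?_, fun H z hz hne => ?_⟩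
    · simpa using H (-z) (by simpa using hz.neg) (by simpa using hne)
    · simpa using H (-z) (by simpa using hz.neg) (by
        intro h2
        exact hne (by rw [← neg_neg z, h2]; simp))

theorem ofReal_mem_adjoin_iff {α c : ℝ} :
    (c : ℂ) ∈ ℚ⟮(α : ℂ)⟯ ↔ c ∈ IntermediateField.adjoin ℚ ({α} : Set ℝ) := by
  let f : ℝ →ₐ[ℚ] ℂ := Complex.ofRealAm.restrictScalars ℚ
  have h : (ℚ⟮α⟯).map f = ℚ⟮(α : ℂ)⟯ := by
    rw [IntermediateField.adjoin_map, Set.image_singleton]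
    rfl
  rw [← h, IntermediateField.mem_map]
  constructor
  · rintro ⟨y, hy, hyc⟩
    have : y = c := Complex.ofReal_injective hyc
    rwa [← this]
  · intro hc
    exact ⟨c, hc, rfl⟩

theorem exists_int_recurrence {α : ℝ} (hint : IsIntegral ℚ (α : ℂ)) (h1 : α ≠ 1) (F : ℝ[X]) :
    ∃ S : ℤ[X], S.eval 1 ≠ 0 ∧
      polyShift S (fun k : ℕ => F.eval (k : ℝ) * α ^ k) = 0 := by
  obtain ⟨b, S, hb, hS⟩ := exists_int_polynomial_map_eq (minpoly ℚ (α : ℂ) ^ (F.natDegree + 1))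
  refine ⟨S, fun h => ?_, ?_⟩
  · have h2 := congrArg (eval 1) hS
    have h3 : eval 1 (S.map (Int.castRingHom ℚ)) = 0 := by
      rw [← map_one (Int.castRingHom ℚ), eval_map_apply, h, map_zero]
    rw [h3, eval_mul, eval_C, eval_pow] at h2
    have h4 : eval 1 (minpoly ℚ (α : ℂ)) = 0 := by
      have : (b : ℚ) ≠ 0 := by exact_mod_cast hb
      simpa [this] using h2.symm
    have h5 := minpoly.root hint h4
    -- A minimal polynomial with the rational root 1 is that of 1, which would give α = 1.
    exact h1 (Complex.ofReal_injective (by simpa using h5.symm))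
  · have hdeg : (F.map Complex.ofRealHom).degree < (F.natDegree + 1 : ℕ) := by
      rw [degree_map]
      exact degree_le_natDegree.trans_lt (by exact_mod_cast Nat.lt_succ_self _)
    have hdvd : (X - C (α : ℂ)) ^ (F.natDegree + 1) ∣ S.map (Int.castRingHom ℂ) := by
      have := congrArg (Polynomial.map (algebraMap ℚ ℂ)) hS
      rw [Polynomial.map_map, show (algebraMap ℚ ℂ).comp (Int.castRingHom ℚ) = Int.castRingHom ℂ
        from RingHom.ext_int _ _] at this
      rw [this, Polynomial.map_mul, Polynomial.map_pow]
      refine Dvd.dvd.mul_left (pow_dvd_pow_of_dvd (dvd_iff_isRoot.2 ?_) _) _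
      rw [IsRoot.def, eval_map_algebraMap, minpoly.aeval]
    have h0 := polyShift_eval_mul_pow_of_dvd hdeg hdvd
    ext k
    have h2 := polyShift_map (Int.castRingHom ℂ) Complex.ofRealHom.toAddMonoidHom
      (fun r m => by simp) S (fun k : ℕ => F.eval (k : ℝ) * α ^ k) k
    have h3 : (fun k : ℕ => Complex.ofRealHom.toAddMonoidHom (F.eval (k : ℝ) * α ^ k)) =
        fun k : ℕ => (F.map Complex.ofRealHom).eval (k : ℂ) * (α : ℂ) ^ k := by
      ext k
      rw [← map_natCast Complex.ofRealHom, eval_map_apply]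
      simp
    rw [h3, h0] at h2
    exact Complex.ofReal_injective h2.symm

theorem limitValues_congr {x y : ℕ → ℝ} (h : x =ᶠ[atTop] y) (θ : UnitAddCircle) :
    limitValues x θ = limitValues y θ := by
  have : (fun k : ℕ => (x k : UnitAddCircle) - k • θ) =ᶠ[atTop]
      fun k : ℕ => (y k : UnitAddCircle) - k • θ := h.mono fun k hk => by simp only [hk]
  simp only [limitValues, MapClusterPt, Filter.map_congr this]

theorem mem_finiteClusterSeq_iff_pisot {α : ℝ} (hint : IsIntegral ℚ (α : ℂ)) (hα : 1 < |α|)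
    {F : ℝ[X]} (hF : F ≠ 0) :
    (fun k : ℕ => ((F.eval (k : ℝ) * α ^ k : ℝ) : UnitAddCircle)) ∈
        finiteClusterSeq UnitAddCircle ↔
      IsPisot |α| ∧ ∀ n : ℕ, F.coeff n ∈ IntermediateField.adjoin ℚ ({α} : Set ℝ) := by
  simp only [isPisot_abs_iff hα, ← ofReal_mem_adjoin_iff]
  refine ⟨fun h => ?_, fun ⟨h1, h2⟩ => eval_mul_pow_mem_finiteClusterSeq h1.1 h1.2 h2⟩
  obtain ⟨p, l, e, hl, he, hx⟩ := exists_int_add_finite_add_null h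
  have := pisot_of_finite_fractional_parts (a := (α : ℂ)) (by simpa using hα) hint
    (F := F.map Complex.ofRealHom) ((Polynomial.map_ne_zero_iff Complex.ofReal_injective).2 hF)
    (p := p) (l := fun k => (l k : ℂ)) (e := fun k => (e k : ℂ)) ?_ ?_ ?_
  · simpa [and_assoc] using this
  · refine (hl.image ((↑) : ℝ → ℂ)).subset ?_
    rintro _ ⟨k, rfl⟩
    exact ⟨l k, ⟨k, rfl⟩, rfl⟩
  · simpa using! (Complex.continuous_ofReal.tendsto 0).comp he
  · intro k
    rw [← map_natCast Complex.ofRealHom, eval_map_apply]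
    have := congrArg ((↑) : ℝ → ℂ) (hx k)
    push_cast at this
    simpa using this

theorem corollary4p2 (α : ℝ) (hα : IsAlgebraic ℚ α) (hα1 : 1 < |α|)
    (F : Polynomial ℝ) (hF : F ≠ 0) (x : ℕ → ℝ)
    (hx : ∀ k : ℕ, 1 ≤ k → x k = F.eval (k : ℝ) * α ^ k) :
    ((IsPisot |α| ∧ ∀ n : ℕ, F.coeff n ∈ IntermediateField.adjoin ℚ ({α} : Set ℝ)) →
        specFin x = ratModInt) ∧
      (¬ (IsPisot |α| ∧ ∀ n : ℕ, F.coeff n ∈ IntermediateField.adjoin ℚ ({α} : Set ℝ)) →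
        specFin x = ∅) ∧
      specCount x ⊆ ratModInt := by
  have hint : IsIntegral ℚ (α : ℂ) := hα.isIntegral.algebraMap
  have hev : x =ᶠ[atTop] fun k : ℕ => F.eval (k : ℝ) * α ^ k :=
    eventually_atTop.2 ⟨1, hx⟩
  have hcount : specCount x ⊆ ratModInt := by
    obtain ⟨S, hS, hS0⟩ := exists_int_recurrence hint (by rintro rfl; simp at hα1) F
    intro θ hθ
    refine specCount_subset_ratModInt (x := fun k : ℕ => F.eval (k : ℝ) * α ^ k) hS (by simp [hS0]) ?_
    change (limitValues x θ).Countable at hθ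
    rwa [limitValues_congr hev] at hθ
  have hfin : ∀ θ ∈ ratModInt, θ ∈ specFin x ↔
      IsPisot |α| ∧ ∀ n : ℕ, F.coeff n ∈ IntermediateField.adjoin ℚ ({α} : Set ℝ) := by
    intro θ hθ
    rw [← mem_finiteClusterSeq_iff_pisot hint hα1 hF, ← finite_limitValues_iff_of_mem_ratModInt hθ,
      ← limitValues_congr hev]
    rfl
  have hsub : specFin x ⊆ ratModInt := fun θ hθ => hcount (Set.Finite.countable hθ)
  refine ⟨fun h => hsub.antisymm fun θ hθ => (hfin θ hθ).2 h, fun h => ?_, hcount⟩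
  exact Set.eq_empty_of_forall_notMem fun θ hθ => h ((hfin θ (hsub hθ)).1 hθ)
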